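/- For integers $n,m,k\ge 0$ and $s\ge 1$ let $T_{n\times m}(s,k)$ be the number of ways of tiling the $n\times m$ rectangle (made of $nm$ unit cells) with $k$ non-overlapping $s\times s$ squares aligned with the unit cells and with $nm-ks^2$ unit squares (monomers); tilings that differ by a flip or rotation of the rectangle are counted as distinct. Let $T_{n\times m}(s)=\sum_{k=0}^{\lfloor nm/s^2\rfloor}T_{n\times m}(s,k)$ and $$T_n(s,z,t)=\sum_{m\ge 0}\sum_{k\ge 0}T_{n\times m}(s,k)\,z^mt^k ,$$ a formal power series in $z$ whose coefficients are polynomials in $t$ (the inner sum is finite). Inserting $t=1$ gives the generating function of the row sums: $T_n(2,z,1)=\sum_{m\ge0}T_{n\times m}(2)z^m$ for every $n\ge 0$. For $s=2$ and $n=4,\dots,8$ the following identities of formal power series hold (each denominator has constant term $1$): $$T_4(2,z,t)=\frac{1 - zt}{1 - z - zt - 2z^2t - z^2t^2 + z^3t^2 + z^3t^3},$$ $$T_4(2,z,1)=\frac{1 - z}{1 - 2z - 3z^2 + 2z^3},$$ $$T_5(2,z,t)=\frac{1 - zt - z^2t^2}{1 - z - zt - 3z^2t - 4z^2t^2 - z^3t^2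 + 3z^3t^3 + 3z^4t^4},$$ $$T_5(2,z,1)=\frac{1 - z - z^2}{1 - 2z - 7z^2 + 2z^3 + 3z^4},$$ $$T_6(2,z,t)=\frac{1 - 2zt - 2z^2t^2 - 2z^2t^3 + 2z^3t^3 + 3z^3t^4 + z^4t^6 - z^5t^7}{1 - z - 2zt - 3z^2t - 8z^2t^2 - 3z^2t^3 + 10z^3t^3 + 5z^3t^4 + 2z^4t^3 + 12z^4t^4 + 11z^4t^5 + 3z^4t^6 - 9z^5t^5 - 15z^5t^6 - 4z^5t^7 + z^6t^7 - 3z^6t^8 - z^6t^9 + 3z^7t^9 + z^7t^{10}},$$ $$T_6(2,z,1)=\frac{1 - z - 5z^2 + z^4}{1 - 2z - 16z^2 - z^3 + 27z^4 - z^5 - 4z^6},$$ $$T_7(2,z,t)=\frac{P_7(z,t)}{Q_7(z,t)},$$ where $$P_7(z,t)=\begin{aligned}&1-2zt-5z^2t^2-7z^2t^3+z^3t^3+8z^3t^4+3z^4t^5+14z^4t^6-6z^5t^7-6z^6t^9\end{aligned}$$ and $$Q_7(z,t)=\begin{aligned}&1-z-2zt-4z^2t-15z^2t^2-11z^2t^3-3z^3t^2+4z^3t^3+16z^3t^4+z^4t^3+30z^4t^4+65z^4t^5+42z^4t^6-5z^5t^5\\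 &-42z^5t^6-38z^5t^7-6z^6t^7-48z^6t^8-62z^6t^9+18z^7t^9+24z^7t^{10}+8z^8t^{11}+24z^8t^{12}\end{aligned},$$ $$T_7(2,z,1)=\frac{1 - 2z - 12z^2 + 9z^3 + 17z^4 - 6z^5 - 6z^6}{1 - 3z - 30z^2 + 17z^3 + 138z^4 - 85z^5 - 116z^6 + 42z^7 + 32z^8},$$ $$T_8(2,z,t)=\frac{P_8(z,t)}{Q_8(z,t)},$$ where $$P_8(z,t)=\begin{aligned}&1-3zt-2zt^2-7z^2t^2-13z^2t^3-2z^2t^4+5z^3t^3+40z^3t^4+37z^3t^5+6z^3t^6+2z^4t^4+11z^4t^5+49z^4t^6\\ &+12z^4t^7-12z^5t^6-104z^5t^7-189z^5t^8-67z^5t^9-6z^5t^{10}-4z^6t^8-41z^6t^9+12z^6t^{11}+2z^6t^{12}\\ &+75z^7t^{10}+271z^7t^{11}+206z^7t^{12}+43z^7t^{13}+2z^7t^{14}+z^8t^{12}-45z^8t^{13}-53z^8t^{14}\\ &-16z^8t^{15}-z^8t^{16}-85z^9t^{14}-156z^9t^{15}-85z^9t^{16}-10z^9t^{17}+17z^{10}t^{16}\\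 &+39z^{10}t^{17}+33z^{10}t^{18}+5z^{10}t^{19}+12z^{11}t^{18}+28z^{11}t^{19}+12z^{11}t^{20}\\ &-2z^{12}t^{20}-8z^{12}t^{21}-6z^{12}t^{22}\end{aligned}$$ and $$Q_8(z,t)=\begin{aligned}&1-z-3zt-2zt^2-4z^2t-20z^2t^2-23z^2t^3-3z^2t^4-2z^3t^2+17z^3t^3+88z^3t^4+60z^3t^5+8z^3t^6+4z^4t^3\\ &+68z^4t^4+207z^4t^5+192z^4t^6+41z^4t^7+2z^4t^8+z^5t^4-22z^5t^5-284z^5t^6-720z^5t^7-607z^5t^8\\ &-156z^5t^9-12z^5t^{10}-13z^6t^6-88z^6t^7-219z^6t^8-426z^6t^9-105z^6t^{10}+4z^6t^{11}+2z^6t^{12}\\ &+50z^7t^8+519z^7t^9+1612z^7t^{10}+2152z^7t^{11}+935z^7t^{12}+154z^7t^{13}+8z^7t^{14}-33z^8t^{10}\\ &-206z^8t^{11}-41z^8t^{12}-202z^8t^{13}-175z^8t^{14}-44z^8t^{15}-3z^8t^{16}-118z^9t^{12}-922z^9t^{13}\\ &-2484z^9t^{14}-1992z^9t^{15}-592z^9t^{16}-65z^9t^{17}-2z^9t^{18}+110z^{10}t^{14}+268z^{10}t^{15}\\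 &+611z^{10}t^{16}+542z^{10}t^{17}+203z^{10}t^{18}+27z^{10}t^{19}+z^{10}t^{20}+7z^{11}t^{16}\\ &+673z^{11}t^{17}+1208z^{11}t^{18}+755z^{11}t^{19}+157z^{11}t^{20}+10z^{11}t^{21}-16z^{12}t^{18}\\ &-178z^{12}t^{19}-329z^{12}t^{20}-273z^{12}t^{21}-69z^{12}t^{22}-5z^{12}t^{23}+2z^{13}t^{20}\\ &-88z^{13}t^{21}-194z^{13}t^{22}-100z^{13}t^{23}-12z^{13}t^{24}+16z^{14}t^{23}+54z^{14}t^{24}\\ &+44z^{14}t^{25}+6z^{14}t^{26}\end{aligned},$$ $$T_8(2,z,1)=\frac{1 - 5z - 22z^2 + 88z^3 + 74z^4 - 378z^5 - 31z^6 + 597z^7 - 114z^8 - 336z^9 + 94z^{10} + 52z^{11} - 16z^{12}}{1 - 6z - 50z^2 + 171z^3 + 514z^4 - 1800z^5 - 845z^6 + 5430z^7 - 704z^8 - 6175z^9 + 1762z^{10} + 2810z^{11} - 870z^{12} - 392z^{13} + 120z^{14}}.$$ -/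

import Mathlib

open scoped Polynomial PowerSeries

namespace SquareTiling

/-- The unit cells of the rectangle that is `n` units wide and `m` units long. -/
def cells (n m : ℕ) : Finset (ℕ × ℕ) := Finset.range n ×ˢ Finset.range m

/-- The unit cells of the `s × s` square with lower left cell `p`. -/
def square (s : ℕ) (p : ℕ × ℕ) : Finset (ℕ × ℕ) :=
  Finset.Ico p.1 (p.1 + s) ×ˢ Finset.Ico p.2 (p.2 + s)

/-- The `s × s` squares placed at the positions in `A`, together with the unit squares placed at
the positions in `B`, tile the `n × m` rectangle: they do not overlap, and they fill exactly the
rectangle. -/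
def IsTiling (n m s : ℕ) (A B : Finset (ℕ × ℕ)) : Prop :=
  (∀ p ∈ A, ∀ q ∈ A, p ≠ q → Disjoint (square s p) (square s q)) ∧
  Disjoint (A.biUnion (square s)) B ∧
  A.biUnion (square s) ∪ B = cells n m

instance (n m s : ℕ) (A B : Finset (ℕ × ℕ)) : Decidable (IsTiling n m s A B) :=
  inferInstanceAs (Decidable (_ ∧ _ ∧ _))

/-- The tilings of the `n × m` rectangle with `k` squares `s × s` and `n m - k s ^ 2` unit squares,
a tiling being given by the set of positions of its `s × s` squares and the set of positions of its
unit squares. -/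
def tilings (n m s k : ℕ) : Finset (Finset (ℕ × ℕ) × Finset (ℕ × ℕ)) :=
  ((cells n m).powerset ×ˢ (cells n m).powerset).filter fun P =>
    IsTiling n m s P.1 P.2 ∧ P.1.card = k ∧ P.2.card + k * s ^ 2 = n * m

/-- The number `T_{n × m}(s, k)`. -/
def numTilings (n m s k : ℕ) : ℕ := (tilings n m s k).card

/-- The number `T_{n × m}(s)`, the sum of `T_{n × m}(s, k)` over `0 ≤ k ≤ ⌊n m / s ^ 2⌋`. -/
def rowSum (n m s : ℕ) : ℕ := ∑ k ∈ Finset.range (n * m / s ^ 2 + 1), numTilings n m s k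

/-- The polynomial `∑ k, T_{n × m}(s, k) t ^ k`; by `coeff_rowPoly` below, no term is left out. -/
noncomputable def rowPoly (n m s : ℕ) : ℤ[X] :=
  ∑ k ∈ Finset.range (n * m + 1), Polynomial.monomial k (numTilings n m s k : ℤ)

theorem numTilings_eq_zero {n m s k : ℕ} (h : n * m < k) : numTilings n m s k = 0 := by
  rw [numTilings, Finset.card_eq_zero, tilings, Finset.filter_eq_empty_iff]
  rintro ⟨A, B⟩ hP ⟨-, hA, -⟩
  have h1 := Finset.card_le_card (Finset.mem_powerset.1 (Finset.mem_product.1 hP).1)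
  simp only [cells, Finset.card_product, Finset.card_range] at h1 hA
  omega

theorem coeff_rowPoly (n m s k : ℕ) : (rowPoly n m s).coeff k = numTilings n m s k := by
  rw [rowPoly, Polynomial.finsetSum_coeff]
  simp only [Polynomial.coeff_monomial]
  rw [Finset.sum_ite_eq']
  split_ifs with h
  · rfl
  · rw [Finset.mem_range, not_lt] at h
    rw [numTilings_eq_zero (Nat.lt_of_succ_le h), Nat.cast_zero]

/-- The bivariate generating function `T_n(s, z, t) = ∑ m, ∑ k, T_{n × m}(s, k) z ^ m t ^ k`, as a
formal power series in `z` whose coefficients are polynomials in `t`. -/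
noncomputable def genFun (n s : ℕ) : ℤ[X]⟦X⟧ := PowerSeries.mk fun m => rowPoly n m s

/-- `T_n(s, z, 1)`: the series `T_n(s, z, t)` with `t = 1` inserted. -/
noncomputable def genFunAtOne (n s : ℕ) : ℤ⟦X⟧ :=
  PowerSeries.map (Polynomial.evalRingHom 1) (genFun n s)

/-- The generating function `∑ m, T_{n × m}(s) z ^ m` of the row sums. -/
noncomputable def rowSumGenFun (n s : ℕ) : ℤ⟦X⟧ := PowerSeries.mk fun m => (rowSum n m s : ℤ)

/-- The power series `F` is the quotient `N / D`, where `D` is an invertible power series. -/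
def IsQuotient {R : Type*} [CommRing R] (F N D : R⟦X⟧) : Prop := IsUnit D ∧ F * D = N

/-- The numerator of `T_7(2, z, t)`. -/
def P7 {R : Type*} [CommRing R] (z t : R) : R :=
  1 - 2 * z * t - 5 * z ^ 2 * t ^ 2 - 7 * z ^ 2 * t ^ 3 + z ^ 3 * t ^ 3 + 8 * z ^ 3 * t ^ 4
    + 3 * z ^ 4 * t ^ 5 + 14 * z ^ 4 * t ^ 6 - 6 * z ^ 5 * t ^ 7 - 6 * z ^ 6 * t ^ 9

/-- The denominator of `T_7(2, z, t)`. -/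
def Q7 {R : Type*} [CommRing R] (z t : R) : R :=
  1 - z - 2 * z * t - 4 * z ^ 2 * t - 15 * z ^ 2 * t ^ 2 - 11 * z ^ 2 * t ^ 3 - 3 * z ^ 3 * t ^ 2
    + 4 * z ^ 3 * t ^ 3 + 16 * z ^ 3 * t ^ 4 + z ^ 4 * t ^ 3 + 30 * z ^ 4 * t ^ 4
    + 65 * z ^ 4 * t ^ 5 + 42 * z ^ 4 * t ^ 6 - 5 * z ^ 5 * t ^ 5 - 42 * z ^ 5 * t ^ 6
    - 38 * z ^ 5 * t ^ 7 - 6 * z ^ 6 * t ^ 7 - 48 * z ^ 6 * t ^ 8 - 62 * z ^ 6 * t ^ 9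
    + 18 * z ^ 7 * t ^ 9 + 24 * z ^ 7 * t ^ 10 + 8 * z ^ 8 * t ^ 11 + 24 * z ^ 8 * t ^ 12

/-- The numerator of `T_8(2, z, t)`. -/
def P8 {R : Type*} [CommRing R] (z t : R) : R :=
  1 - 3 * z * t - 2 * z * t ^ 2 - 7 * z ^ 2 * t ^ 2 - 13 * z ^ 2 * t ^ 3 - 2 * z ^ 2 * t ^ 4
    + 5 * z ^ 3 * t ^ 3 + 40 * z ^ 3 * t ^ 4 + 37 * z ^ 3 * t ^ 5 + 6 * z ^ 3 * t ^ 6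
    + 2 * z ^ 4 * t ^ 4 + 11 * z ^ 4 * t ^ 5 + 49 * z ^ 4 * t ^ 6 + 12 * z ^ 4 * t ^ 7
    - 12 * z ^ 5 * t ^ 6 - 104 * z ^ 5 * t ^ 7 - 189 * z ^ 5 * t ^ 8 - 67 * z ^ 5 * t ^ 9
    - 6 * z ^ 5 * t ^ 10 - 4 * z ^ 6 * t ^ 8 - 41 * z ^ 6 * t ^ 9 + 12 * z ^ 6 * t ^ 11
    + 2 * z ^ 6 * t ^ 12 + 75 * z ^ 7 * t ^ 10 + 271 * z ^ 7 * t ^ 11 + 206 * z ^ 7 * t ^ 12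
    + 43 * z ^ 7 * t ^ 13 + 2 * z ^ 7 * t ^ 14 + z ^ 8 * t ^ 12 - 45 * z ^ 8 * t ^ 13
    - 53 * z ^ 8 * t ^ 14 - 16 * z ^ 8 * t ^ 15 - z ^ 8 * t ^ 16 - 85 * z ^ 9 * t ^ 14
    - 156 * z ^ 9 * t ^ 15 - 85 * z ^ 9 * t ^ 16 - 10 * z ^ 9 * t ^ 17 + 17 * z ^ 10 * t ^ 16
    + 39 * z ^ 10 * t ^ 17 + 33 * z ^ 10 * t ^ 18 + 5 * z ^ 10 * t ^ 19 + 12 * z ^ 11 * t ^ 18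
    + 28 * z ^ 11 * t ^ 19 + 12 * z ^ 11 * t ^ 20 - 2 * z ^ 12 * t ^ 20 - 8 * z ^ 12 * t ^ 21
    - 6 * z ^ 12 * t ^ 22

/-- The denominator of `T_8(2, z, t)`. -/
def Q8 {R : Type*} [CommRing R] (z t : R) : R :=
  1 - z - 3 * z * t - 2 * z * t ^ 2 - 4 * z ^ 2 * t - 20 * z ^ 2 * t ^ 2 - 23 * z ^ 2 * t ^ 3
    - 3 * z ^ 2 * t ^ 4 - 2 * z ^ 3 * t ^ 2 + 17 * z ^ 3 * t ^ 3 + 88 * z ^ 3 * t ^ 4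
    + 60 * z ^ 3 * t ^ 5 + 8 * z ^ 3 * t ^ 6 + 4 * z ^ 4 * t ^ 3 + 68 * z ^ 4 * t ^ 4
    + 207 * z ^ 4 * t ^ 5 + 192 * z ^ 4 * t ^ 6 + 41 * z ^ 4 * t ^ 7 + 2 * z ^ 4 * t ^ 8
    + z ^ 5 * t ^ 4 - 22 * z ^ 5 * t ^ 5 - 284 * z ^ 5 * t ^ 6 - 720 * z ^ 5 * t ^ 7
    - 607 * z ^ 5 * t ^ 8 - 156 * z ^ 5 * t ^ 9 - 12 * z ^ 5 * t ^ 10 - 13 * z ^ 6 * t ^ 6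
    - 88 * z ^ 6 * t ^ 7 - 219 * z ^ 6 * t ^ 8 - 426 * z ^ 6 * t ^ 9 - 105 * z ^ 6 * t ^ 10
    + 4 * z ^ 6 * t ^ 11 + 2 * z ^ 6 * t ^ 12 + 50 * z ^ 7 * t ^ 8 + 519 * z ^ 7 * t ^ 9
    + 1612 * z ^ 7 * t ^ 10 + 2152 * z ^ 7 * t ^ 11 + 935 * z ^ 7 * t ^ 12 + 154 * z ^ 7 * t ^ 13
    + 8 * z ^ 7 * t ^ 14 - 33 * z ^ 8 * t ^ 10 - 206 * z ^ 8 * t ^ 11 - 41 * z ^ 8 * t ^ 12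
    - 202 * z ^ 8 * t ^ 13 - 175 * z ^ 8 * t ^ 14 - 44 * z ^ 8 * t ^ 15 - 3 * z ^ 8 * t ^ 16
    - 118 * z ^ 9 * t ^ 12 - 922 * z ^ 9 * t ^ 13 - 2484 * z ^ 9 * t ^ 14 - 1992 * z ^ 9 * t ^ 15
    - 592 * z ^ 9 * t ^ 16 - 65 * z ^ 9 * t ^ 17 - 2 * z ^ 9 * t ^ 18 + 110 * z ^ 10 * t ^ 14
    + 268 * z ^ 10 * t ^ 15 + 611 * z ^ 10 * t ^ 16 + 542 * z ^ 10 * t ^ 17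
    + 203 * z ^ 10 * t ^ 18 + 27 * z ^ 10 * t ^ 19 + z ^ 10 * t ^ 20 + 7 * z ^ 11 * t ^ 16
    + 673 * z ^ 11 * t ^ 17 + 1208 * z ^ 11 * t ^ 18 + 755 * z ^ 11 * t ^ 19
    + 157 * z ^ 11 * t ^ 20 + 10 * z ^ 11 * t ^ 21 - 16 * z ^ 12 * t ^ 18 - 178 * z ^ 12 * t ^ 19
    - 329 * z ^ 12 * t ^ 20 - 273 * z ^ 12 * t ^ 21 - 69 * z ^ 12 * t ^ 22 - 5 * z ^ 12 * t ^ 23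
    + 2 * z ^ 13 * t ^ 20 - 88 * z ^ 13 * t ^ 21 - 194 * z ^ 13 * t ^ 22 - 100 * z ^ 13 * t ^ 23
    - 12 * z ^ 13 * t ^ 24 + 16 * z ^ 14 * t ^ 23 + 54 * z ^ 14 * t ^ 24 + 44 * z ^ 14 * t ^ 25
    + 6 * z ^ 14 * t ^ 26

end SquareTiling

/-!
A tiling is determined by the set of its `2 × 2` squares, since the unit squares are the cells that
remain (`numTilings_two`). Peeling off the squares that start in the topmost row turns the count
into a transfer between row states, a state being the set of positions at which squares start in
one row: `rowPoly n m 2` is the entry at the empty state of `transfer n t m`, a vector that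
satisfies `v (m + 1) = M * v m` for a fixed matrix `M` over `ℤ[t]` (`rowPoly_two_eq_transfer`).

Let `q₀, …, q_d` be the coefficients of `z ^ j` in the asserted denominator. The vectors
`e m = ∑ j, q_j * v (m - j)` satisfy `e (m + 1) = M * e m` as well, so that `e d = 0` implies
`e m = 0` for all `m ≥ d` (`dot_transfer_eq_zero`). What is left of each generating function is
therefore a finite set of identities in `ℤ[t]`: `e d = 0` for each state, and the equality of the
first `d` coefficients of the asserted numerator with those of the product
(`isQuotient_genFun_two`).

These identities between polynomials are verified by evaluation at the single integer
`t = 10 ^ 24`. A polynomial whose coefficients have absolute values with sum less than `N` vanishes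
if its value at `N` does, by uniqueness of base `N` digits (`NormLE.eq_zero`), and the sums of
absolute values are bounded by running the same transfer at `t = 1`. The remaining computation with
integers is small, and the kernel does it.

The row sum identities follow by inserting `t = 1`, where for `n = 6` a factor `1 - z` cancels.
-/

namespace SquareTiling

/-! ### Polynomials determined by one value -/

/-- A polynomial with natural coefficients smaller than `N` is determined by its value at `N`, its
coefficients being the base `N` digits; the value at `1` bounds all coefficients at once. -/
theorem eq_of_eval_eq_of_eval_one_lt {p q : ℕ[X]} {N : ℕ} (hp : p.eval 1 < N) (hq : q.eval 1 < N)
    (h : p.eval N = q.eval N) : p = q := by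
  ext k
  induction k generalizing p q with
  | zero =>
    have key (r : ℕ[X]) (hr : r.eval 1 < N) : r.eval N % N = r.coeff 0 := by
      have h1 := congrArg (Polynomial.eval 1) r.divX_mul_X_add
      have h2 := congrArg (Polynomial.eval N) r.divX_mul_X_add
      simp only [Polynomial.eval_add, Polynomial.eval_mul, Polynomial.eval_X,
        Polynomial.eval_C] at h1 h2
      rw [← h2, Nat.mul_add_mod', Nat.mod_eq_of_lt (by omega)]
    rw [← key p hp, ← key q hq, h]
  | succ k ih =>
    have key (r : ℕ[X]) (hr : r.eval 1 < N) :
        r.divX.eval 1 < N ∧ r.divX.eval N = r.eval N / N := by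
      have h1 := congrArg (Polynomial.eval 1) r.divX_mul_X_add
      have h2 := congrArg (Polynomial.eval N) r.divX_mul_X_add
      simp only [Polynomial.eval_add, Polynomial.eval_mul, Polynomial.eval_X,
        Polynomial.eval_C] at h1 h2
      refine ⟨by omega, ?_⟩
      rw [← h2, mul_comm, Nat.mul_add_div (by omega), Nat.div_eq_of_lt (by omega), add_zero]
    rw [← Polynomial.coeff_divX, ← Polynomial.coeff_divX]
    exact ih (key p hp).1 (key q hq).1 (by rw [(key p hp).2, (key q hq).2, h])

/-- `NormLE p b` says that the absolute values of the coefficients of `p` add up to at most `b`.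
It is phrased through a decomposition of `p` as a difference of polynomials with natural
coefficients, for which the sum of the coefficients is the value at `1`. -/
def NormLE (p : ℤ[X]) (b : ℕ) : Prop :=
  ∃ u v : ℕ[X], p = u.map (Nat.castRingHom ℤ) - v.map (Nat.castRingHom ℤ) ∧
    u.eval 1 + v.eval 1 ≤ b

namespace NormLE

theorem zero : NormLE 0 0 := ⟨0, 0, by simp, by simp⟩

theorem map_natCast (p : ℕ[X]) : NormLE (p.map (Nat.castRingHom ℤ)) (p.eval 1) :=
  ⟨p, 0, by simp, by simp⟩

theorem X : NormLE Polynomial.X 1 := ⟨Polynomial.X, 0, by simp, by simp⟩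

theorem intCast (a : ℤ) : NormLE (a : ℤ[X]) a.natAbs := by
  refine ⟨(a.toNat : ℕ[X]), ((-a).toNat : ℕ[X]), ?_, ?_⟩
  · rw [Polynomial.map_natCast, Polynomial.map_natCast]
    conv_lhs => rw [← Int.toNat_sub_toNat_neg a]
    push_cast
    rfl
  · rw [Polynomial.eval_natCast, Polynomial.eval_natCast]
    simp only [Nat.cast_id]
    omega

variable {p q : ℤ[X]} {b c : ℕ}

theorem add (hp : NormLE p b) (hq : NormLE q c) : NormLE (p + q) (b + c) := by
  obtain ⟨u, v, rfl, h⟩ := hp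
  obtain ⟨u', v', rfl, h'⟩ := hq
  refine ⟨u + u', v + v', ?_, ?_⟩
  · simp only [Polynomial.map_add]
    ring
  · simp only [Polynomial.eval_add]
    omega

theorem sub (hp : NormLE p b) (hq : NormLE q c) : NormLE (p - q) (b + c) := by
  obtain ⟨u', v', rfl, h'⟩ := hq
  rw [sub_eq_add_neg]
  exact hp.add ⟨v', u', by ring, by omega⟩

theorem mul (hp : NormLE p b) (hq : NormLE q c) : NormLE (p * q) (b * c) := by
  obtain ⟨u, v, rfl, h⟩ := hp
  obtain ⟨u', v', rfl, h'⟩ := hq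
  refine ⟨u * u' + v * v', u * v' + v * u', ?_, ?_⟩
  · simp only [Polynomial.map_add, Polynomial.map_mul]
    ring
  · simp only [Polynomial.eval_add, Polynomial.eval_mul]
    calc _ = (u.eval 1 + v.eval 1) * (u'.eval 1 + v'.eval 1) := by ring
      _ ≤ _ := Nat.mul_le_mul h h'

theorem eq_zero {N : ℕ} (hp : NormLE p b) (hb : b < N) (h : p.eval (N : ℤ) = 0) : p = 0 := by
  obtain ⟨u, v, rfl, h'⟩ := hp
  have key (r : ℕ[X]) : (r.map (Nat.castRingHom ℤ)).eval (N : ℤ) = (r.eval N : ℕ) := by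
    simp [Polynomial.eval_natCast_map]
  rw [Polynomial.eval_sub, key, key, sub_eq_zero, Nat.cast_inj] at h
  rw [eq_of_eval_eq_of_eval_one_lt (by omega) (by omega) h, sub_self]

end NormLE

/-! ### Polynomials and recurrences given by lists of coefficients -/

/-- The value `c₀ + c₁ x + c₂ x² + ⋯` of the polynomial with the coefficients `c₀, c₁, c₂, …`. -/
def horner {R : Type*} [Semiring R] (x : R) (c : List R) : R := c.foldr (fun a r => a + x * r) 0

/-- The value at `t` of the polynomial with the integer coefficients `c₀, c₁, c₂, …`. -/
def intHorner {R : Type*} [Ring R] (t : R) (c : List ℤ) : R := horner t (c.map Int.cast)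

/-- The value at `(z, t)` of a bivariate polynomial; the `i`-th list holds the coefficients of
`z ^ i`, by increasing powers of `t`. -/
def bivariate {R : Type*} [Ring R] (z t : R) (c : List (List ℤ)) : R :=
  horner z (c.map (intHorner t))

/-- The sum `a₀ b₀ + a₁ b₁ + ⋯`, as long as both lists have entries. -/
def dot {R : Type*} [Semiring R] : List R → List R → R
  | a :: u, b :: v => a * b + dot u v
  | _, _ => 0

/-- The list `[f m, f (m - 1), …, f 0]`. -/
def history {α : Type*} (f : ℕ → α) : ℕ → List α
  | 0 => [f 0]
  | m + 1 => f (m + 1) :: history f m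

section
variable {R S : Type*}

theorem history_drop (f : ℕ → R) (m k : ℕ) : (history f (m + k)).drop k = history f m := by
  induction k with
  | zero => rfl
  | succ k ih => rw [← Nat.add_assoc, history, List.drop_succ_cons, ih]

theorem map_history (φ : R → S) (f : ℕ → R) (m : ℕ) :
    (history f m).map φ = history (fun k => φ (f k)) m := by
  induction m with
  | zero => rfl
  | succ m ih => rw [history, List.map_cons, ih, history]

theorem map_dot [Semiring R] [Semiring S] (φ : R →+* S) (u v : List R) :
    φ (dot u v) = dot (u.map φ) (v.map φ) := by
  induction u generalizing v with
  | nil => simp [dot]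
  | cons a u ih => cases v <;> simp [dot, ih]

theorem map_intHorner [Ring R] [Ring S] (φ : R →+* S) (t : R) (c : List ℤ) :
    φ (intHorner t c) = intHorner (φ t) c := by
  induction c with
  | nil => simp [intHorner, horner]
  | cons a c ih =>
    simp only [intHorner, horner, List.map_cons, List.foldr_cons] at ih ⊢
    rw [map_add, map_mul, ih, map_intCast]

theorem coeff_horner [CommRing R] (c : List R) (m : ℕ) :
    PowerSeries.coeff m (horner PowerSeries.X (c.map PowerSeries.C)) = c.getD m 0 := by
  induction c generalizing m with
  | nil => simp [horner]
  | cons a c ih =>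
    simp only [horner, List.map_cons, List.foldr_cons] at ih ⊢
    rw [map_add]
    cases m with
    | zero => simp
    | succ m => rw [PowerSeries.coeff_succ_X_mul, ih]; simp

/-- Multiplying a power series by a polynomial applies the corresponding linear recurrence to its
coefficients. -/
theorem coeff_mk_mul_horner [CommRing R] (f : ℕ → R) (c : List R) (m : ℕ) :
    PowerSeries.coeff m (PowerSeries.mk f * horner PowerSeries.X (c.map PowerSeries.C)) =
      dot c (history f m) := by
  induction c generalizing m with
  | nil => simp [horner, dot]
  | cons a c ih =>
    simp only [horner, List.map_cons, List.foldr_cons] at ih ⊢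
    rw [mul_add, mul_left_comm, map_add, PowerSeries.coeff_mul_C, PowerSeries.coeff_mk]
    cases m with
    | zero => cases c <;> simp [history, dot, mul_comm]
    | succ m => rw [PowerSeries.coeff_succ_X_mul, ih, history, dot, mul_comm]

/-- A linear recurrence commutes with a linear map that advances sequences by one step, as long as
it does not reach beyond the beginning of the sequence. -/
theorem dot_history_succ [CommSemiring R] {ι : Type*} (s : Finset ι) (w : ι → R) (f : ℕ → R)
    (g : ι → ℕ → R) (hf : ∀ m, f (m + 1) = ∑ i ∈ s, w i * g i m) (c : List R) (m : ℕ)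
    (hm : c.length ≤ m + 1) :
    dot c (history f (m + 1)) = ∑ i ∈ s, w i * dot c (history (g i) m) := by
  induction c generalizing m with
  | nil => simp [dot]
  | cons a c ih =>
    rw [history, dot, hf, Finset.mul_sum]
    cases m with
    | zero =>
      obtain rfl : c = [] := by simpa using hm
      simp [history, dot, mul_left_comm]
    | succ m =>
      rw [ih m (by simpa using hm), ← Finset.sum_add_distrib]
      refine Finset.sum_congr rfl fun i _ => ?_
      rw [history, dot]
      ring

end

theorem NormLE.intHorner (c : List ℤ) :
    NormLE (intHorner Polynomial.X c) (horner 1 (c.map Int.natAbs)) := by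
  induction c with
  | nil => exact .zero
  | cons a c ih => exact (NormLE.intCast a).add (NormLE.X.mul ih)

theorem NormLE.dot {α : Type*} (p : α → ℤ[X]) (b : α → ℕ) (hp : ∀ i, NormLE (p i) (b i))
    (f : ℕ → ℤ[X]) (g : ℕ → ℕ) (hf : ∀ i, NormLE (f i) (g i)) (u : List α) (m : ℕ) :
    NormLE (dot (u.map p) (history f m)) (dot (u.map b) (history g m)) := by
  induction u generalizing m with
  | nil => exact .zero
  | cons a u ih =>
    cases m with
    | zero => cases u <;> exact ((hp a).mul (hf 0)).add .zero
    | succ m => exact ((hp a).mul (hf _)).add (ih m)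

/-! ### Tilings as sets of squares -/

/-- The `2 × 2` squares at `p` and `q` do not overlap. -/
def Apart (p q : ℕ × ℕ) : Prop :=
  p.1 + 2 ≤ q.1 ∨ q.1 + 2 ≤ p.1 ∨ p.2 + 2 ≤ q.2 ∨ q.2 + 2 ≤ p.2

instance (p q : ℕ × ℕ) : Decidable (Apart p q) := inferInstanceAs (Decidable (_ ∨ _))

theorem Apart.symm {p q : ℕ × ℕ} (h : Apart p q) : Apart q p := by
  unfold Apart at *
  omega

theorem mem_square_two {p q : ℕ × ℕ} :
    q ∈ square 2 p ↔ (p.1 ≤ q.1 ∧ q.1 < p.1 + 2) ∧ p.2 ≤ q.2 ∧ q.2 < p.2 + 2 := by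
  rw [square, Finset.mem_product, Finset.mem_Ico, Finset.mem_Ico]

theorem mem_cells {n m : ℕ} {q : ℕ × ℕ} : q ∈ cells n m ↔ q.1 < n ∧ q.2 < m := by
  rw [cells, Finset.mem_product, Finset.mem_range, Finset.mem_range]

theorem card_square_two (p : ℕ × ℕ) : (square 2 p).card = 4 := by
  simp [square, Finset.card_product]

theorem disjoint_square_two {p q : ℕ × ℕ} :
    Disjoint (square 2 p) (square 2 q) ↔ Apart p q := by
  rw [Finset.disjoint_left]
  constructor
  · intro h
    by_contra hn
    refine h (a := (max p.1 q.1, max p.2 q.2)) ?_ ?_ <;> rw [mem_square_two] <;>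
      unfold Apart at hn <;> dsimp only <;> omega
  · intro h x hp hq
    rw [mem_square_two] at hp hq
    unfold Apart at h
    omega

theorem square_two_subset_cells {n m : ℕ} {p : ℕ × ℕ} :
    square 2 p ⊆ cells n m ↔ p.1 < n - 1 ∧ p.2 < m - 1 := by
  constructor
  · intro h
    have := mem_cells.1 (h (mem_square_two.2 (show (p.1 ≤ (p.1 + 1, p.2 + 1).1 ∧ _) ∧ _ by
      dsimp only; omega)))
    dsimp only at this
    omega
  · intro h q hq
    rw [mem_square_two] at hq
    rw [mem_cells]
    omega

/-- The sets of positions of non-overlapping `2 × 2` squares which lie in the columns of a rectangle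
of width `n`, which start in the first `m` rows, and which avoid the squares that start in row `m`
at the positions in `S`. -/
def packings (n m : ℕ) (S : Finset ℕ) : Finset (Finset (ℕ × ℕ)) :=
  (cells (n - 1) m).powerset.filter fun A =>
    (∀ p ∈ A, ∀ q ∈ A, p ≠ q → Apart p q) ∧ ∀ p ∈ A, ∀ i ∈ S, Apart p (i, m)

theorem mem_packings {n m : ℕ} {S : Finset ℕ} {A : Finset (ℕ × ℕ)} :
    A ∈ packings n m S ↔ A ⊆ cells (n - 1) m ∧ (∀ p ∈ A, ∀ q ∈ A, p ≠ q → Apart p q) ∧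
      ∀ p ∈ A, ∀ i ∈ S, Apart p (i, m) := by
  rw [packings, Finset.mem_filter, Finset.mem_powerset]

theorem card_biUnion_square_two {A : Finset (ℕ × ℕ)} (h : ∀ p ∈ A, ∀ q ∈ A, p ≠ q → Apart p q) :
    (A.biUnion (square 2)).card = A.card * 4 := by
  rw [Finset.card_biUnion fun p hp q hq hpq => disjoint_square_two.2 (h p hp q hq hpq)]
  simp [card_square_two]

/-- The unit squares of a tiling are the cells that its `2 × 2` squares leave free. -/
theorem numTilings_two (n m k : ℕ) :
    numTilings n m 2 k = ((packings n (m - 1) ∅).filter fun A => A.card = k).card := by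
  have hsub {A : Finset (ℕ × ℕ)} :
      A ⊆ cells (n - 1) (m - 1) ↔ A.biUnion (square 2) ⊆ cells n m := by
    rw [Finset.biUnion_subset]
    refine forall₂_congr fun p _ => ?_
    rw [square_two_subset_cells, mem_cells]
  rw [numTilings]
  refine Finset.card_nbij' Prod.fst (fun A => (A, cells n m \ A.biUnion (square 2))) ?_ ?_ ?_ ?_
  · rintro ⟨A, B⟩ h
    simp only [tilings, Finset.coe_filter, Set.mem_ofPred_eq, IsTiling, disjoint_square_two] at h ⊢
    obtain ⟨-, ⟨h1, -, h3⟩, h4, -⟩ := h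
    refine ⟨mem_packings.2 ⟨hsub.2 ?_, h1, by simp⟩, h4⟩
    rw [← h3]
    exact Finset.subset_union_left
  · intro A h
    simp only [tilings, Finset.coe_filter, Set.mem_ofPred_eq, IsTiling, disjoint_square_two,
      mem_packings, hsub, Finset.mem_product, Finset.mem_powerset] at h ⊢
    obtain ⟨⟨h1, h2, -⟩, rfl⟩ := h
    have h3 : A ⊆ cells n m := fun p hp => by
      have := mem_cells.1 (hsub.2 h1 hp)
      exact mem_cells.2 (by omega)
    refine ⟨⟨h3, Finset.sdiff_subset⟩, ⟨h2, Finset.disjoint_sdiff, ?_⟩, rfl, ?_⟩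
    · exact Finset.union_sdiff_of_subset h1
    · have h4 : (cells n m).card = n * m := by simp [cells]
      rw [Finset.card_sdiff_of_subset h1, card_biUnion_square_two h2, h4]
      have := Finset.card_le_card h1
      rw [card_biUnion_square_two h2, h4] at this
      omega
  · rintro ⟨A, B⟩ h
    rw [Finset.mem_coe, tilings, Finset.mem_filter] at h
    obtain ⟨-, ⟨-, h2, h3⟩, -⟩ := h
    simp only [Prod.mk.injEq, true_and]
    rw [← h3, Finset.union_sdiff_cancel_left h2]
  · intro A _
    rfl

theorem rowPoly_two (n m : ℕ) :
    rowPoly n m 2 = ∑ A ∈ packings n (m - 1) ∅, (Polynomial.X : ℤ[X]) ^ A.card := by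
  ext k
  rw [coeff_rowPoly, numTilings_two, Polynomial.finsetSum_coeff]
  simp only [Polynomial.coeff_X_pow, eq_comm (a := k)]
  rw [Finset.sum_boole]

/-! ### Transfer between consecutive rows -/

/-- Squares that start in adjacent rows, at the positions in `R` in one row and at those in `S` in
the other, do not overlap. -/
def Compatible (R S : Finset ℕ) : Prop := ∀ i ∈ R, ∀ j ∈ S, i + 2 ≤ j ∨ j + 2 ≤ i

instance (R S : Finset ℕ) : Decidable (Compatible R S) :=
  inferInstanceAs (Decidable (∀ i ∈ R, ∀ j ∈ S, _))

/-- The sets of positions below `k` at which non-overlapping squares can start in one row. -/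
def rowStates (k : ℕ) : Finset (Finset ℕ) :=
  (Finset.range k).powerset.filter fun R => ∀ i ∈ R, ∀ j ∈ R, i ≠ j → i + 2 ≤ j ∨ j + 2 ≤ i

theorem mem_rowStates {k : ℕ} {R : Finset ℕ} : R ∈ rowStates k ↔
    R ⊆ Finset.range k ∧ ∀ i ∈ R, ∀ j ∈ R, i ≠ j → i + 2 ≤ j ∨ j + 2 ≤ i := by
  rw [rowStates, Finset.mem_filter, Finset.mem_powerset]

/-- The generating function of the tilings of the `n × m` rectangle by `2 × 2` squares that already
holds the lower halves of squares at the positions `S` in its last row: `t` marks the other squares.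
Without rows there is no place for such halves. -/
def transfer {R : Type*} [CommSemiring R] (n : ℕ) (t : R) : ℕ → Finset ℕ → R
  | 0, S => if S = ∅ then 1 else 0
  | m + 1, S => ∑ R ∈ rowStates (n - 1) with Compatible S R, t ^ R.card * transfer n t m R

/-- A packing that starts in the first `m + 1` rows consists of its squares in row `m` and a packing
that starts in the first `m` rows. -/
theorem sum_packings_succ {α : Type*} [CommSemiring α] (n m : ℕ) (S : Finset ℕ) (t : α) :
    ∑ A ∈ packings n (m + 1) S, t ^ A.card =
      ∑ R ∈ rowStates (n - 1) with Compatible S R,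
        t ^ R.card * ∑ A ∈ packings n m R, t ^ A.card := by
  simp only [Finset.mul_sum]
  rw [Finset.sum_sigma']
  refine Finset.sum_bij'
    (fun A _ => ⟨(A.filter fun p => p.2 = m).image Prod.fst, A.filter fun p => p.2 ≠ m⟩)
    (fun P _ => P.1.image (fun i => (i, m)) ∪ P.2) ?_ ?_ ?_ ?_ ?_
  · intro A hA
    obtain ⟨h1, h2, h3⟩ := mem_packings.1 hA
    have hmem {i : ℕ} (hi : i ∈ (A.filter fun p => p.2 = m).image Prod.fst) : (i, m) ∈ A := by
      obtain ⟨⟨a, b⟩, hp, rfl⟩ := Finset.mem_image.1 hi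
      obtain ⟨hp, h⟩ := Finset.mem_filter.1 hp
      rwa [← show b = m from h]
    rw [Finset.mem_sigma, Finset.mem_filter, mem_rowStates, mem_packings]
    refine ⟨⟨⟨fun i hi => ?_, fun i hi j hj hij => ?_⟩, fun i hi j hj => ?_⟩, fun p hp => ?_,
      fun p hp q hq => ?_, fun p hp i hi => ?_⟩
    · exact Finset.mem_range.2 (mem_cells.1 (h1 (hmem hi))).1
    · have := h2 _ (hmem hi) _ (hmem hj) (by simpa using hij)
      simp only [Apart] at this
      omega
    · have := h3 _ (hmem hj) i hi
      simp only [Apart] at this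
      omega
    · obtain ⟨hp, hpm⟩ := Finset.mem_filter.1 hp
      have := mem_cells.1 (h1 hp)
      exact mem_cells.2 (by omega)
    · exact h2 p (Finset.mem_filter.1 hp).1 q (Finset.mem_filter.1 hq).1
    · obtain ⟨hp, hpm⟩ := Finset.mem_filter.1 hp
      exact h2 p hp _ (hmem hi) fun h => hpm (by rw [h])
  · rintro ⟨R, A⟩ hP
    rw [Finset.mem_sigma, Finset.mem_filter, mem_rowStates, mem_packings] at hP
    obtain ⟨⟨⟨h1, h2⟩, h3⟩, h4, h5, h6⟩ := hP
    dsimp only at h1 h2 h3 h4 h5 h6 ⊢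
    rw [mem_packings]
    refine ⟨fun p hp => ?_, fun p hp q hq hpq => ?_, fun p hp i hi => ?_⟩
    · rcases Finset.mem_union.1 hp with hp | hp
      · obtain ⟨i, hi, rfl⟩ := Finset.mem_image.1 hp
        exact mem_cells.2 ⟨Finset.mem_range.1 (h1 hi), Nat.lt_succ_self m⟩
      · have := mem_cells.1 (h4 hp)
        exact mem_cells.2 (by omega)
    · rcases Finset.mem_union.1 hp with hp | hp <;> rcases Finset.mem_union.1 hq with hq | hq
      · obtain ⟨i, hi, rfl⟩ := Finset.mem_image.1 hp
        obtain ⟨j, hj, rfl⟩ := Finset.mem_image.1 hq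
        have := h2 i hi j hj fun h => hpq (by rw [h])
        simp only [Apart]
        omega
      · obtain ⟨i, hi, rfl⟩ := Finset.mem_image.1 hp
        exact (h6 q hq i hi).symm
      · obtain ⟨i, hi, rfl⟩ := Finset.mem_image.1 hq
        exact h6 p hp i hi
      · exact h5 p hp q hq hpq
    · rcases Finset.mem_union.1 hp with hp | hp
      · obtain ⟨j, hj, rfl⟩ := Finset.mem_image.1 hp
        have := h3 i hi j hj
        simp only [Apart]
        omega
      · have := mem_cells.1 (h4 hp)
        simp only [Apart]
        omega
  · intro A _
    ext ⟨a, b⟩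
    simp only [Finset.mem_union, Finset.mem_image, Finset.mem_filter, Prod.mk.injEq, Prod.exists]
    grind
  · rintro ⟨R, A⟩ hP
    rw [Finset.mem_sigma, mem_packings] at hP
    have h4 (p : ℕ × ℕ) (hp : p ∈ A) : p.2 < m := (mem_cells.1 (hP.2.1 hp)).2
    have e1 : ((R.image (fun i => (i, m)) ∪ A).filter fun p => p.2 = m).image Prod.fst = R := by
      ext i
      simp only [Finset.mem_union, Finset.mem_image, Finset.mem_filter, Prod.exists,
        Prod.mk.injEq]
      constructor
      · grind
      · exact fun hi => ⟨i, m, ⟨Or.inl ⟨i, hi, rfl, rfl⟩, rfl⟩, rfl⟩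
    have e2 : (R.image (fun i => (i, m)) ∪ A).filter (fun p => p.2 ≠ m) = A := by
      ext ⟨a, b⟩
      simp only [Finset.mem_union, Finset.mem_image, Finset.mem_filter, Prod.mk.injEq]
      grind
    simp only [e1, e2]
  · intro A _
    dsimp only
    rw [Finset.card_image_of_injOn, ← pow_add, Finset.card_filter_add_card_filter_not]
    rintro ⟨a, b⟩ hp ⟨c, d⟩ hq h
    grind

theorem transfer_one {α : Type*} [CommSemiring α] (n : ℕ) (S : Finset ℕ) (t : α) :
    transfer n t 1 S = 1 := by
  rw [transfer, Finset.sum_eq_single ∅]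
  · simp [transfer]
  · intro R _ hR
    simp [transfer, hR]
  · intro h
    exact absurd (Finset.mem_filter.2 ⟨by simp [mem_rowStates], by simp [Compatible]⟩) h

theorem packings_zero (n : ℕ) (S : Finset ℕ) : packings n 0 S = {∅} := by
  ext A
  rw [mem_packings, Finset.mem_singleton]
  constructor
  · rintro ⟨h, -⟩
    simpa [cells] using h
  · rintro rfl
    simp

theorem transfer_succ {α : Type*} [CommSemiring α] (n m : ℕ) (S : Finset ℕ) (t : α) :
    transfer n t (m + 1) S = ∑ A ∈ packings n m S, t ^ A.card := by
  induction m generalizing S with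
  | zero => simp [transfer_one, packings_zero]
  | succ m ih =>
    rw [transfer, sum_packings_succ]
    simp only [ih]

theorem rowPoly_two_eq_transfer (n m : ℕ) :
    rowPoly n m 2 = transfer n (Polynomial.X : ℤ[X]) m ∅ := by
  rw [rowPoly_two]
  cases m with
  | zero => simp [packings_zero, transfer]
  | succ m => rw [transfer_succ, Nat.add_sub_cancel]

/-! ### Computing the transfer -/

/-- The sets of positions below `k` at which non-overlapping squares can start in one row, as lists
without repetitions. -/
def rowLists : ℕ → List (List ℕ)
  | 0 => [[]]
  | 1 => [[], [0]]
  | k + 2 => rowLists (k + 1) ++ (rowLists k).map (List.cons (k + 1))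

theorem rowLists_spec {k : ℕ} {l : List ℕ} (hl : l ∈ rowLists k) :
    l.Nodup ∧ ∀ i ∈ l, i < k := by
  induction k using rowLists.induct generalizing l with
  | case1 => simp_all [rowLists]
  | case2 => rcases (by simpa [rowLists] using hl : l = [] ∨ l = [0]) with rfl | rfl <;> simp
  | case3 k ih1 ih2 =>
    rw [rowLists, List.mem_append, List.mem_map] at hl
    rcases hl with hl | ⟨l, hl, rfl⟩
    · exact ⟨(ih1 hl).1, fun i hi => ((ih1 hl).2 i hi).trans (Nat.lt_succ_self _)⟩
    · have := ih2 hl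
      refine ⟨List.nodup_cons.2 ⟨fun h => ?_, this.1⟩, fun i hi => ?_⟩
      · have := this.2 _ h
        omega
      · rcases List.mem_cons.1 hi with rfl | hi
        · omega
        · have := this.2 _ hi
          omega

theorem nil_mem_rowLists (k : ℕ) : [] ∈ rowLists k := by
  induction k using rowLists.induct with
  | case1 => simp [rowLists]
  | case2 => simp [rowLists]
  | case3 k ih1 ih2 => exact List.mem_append_left _ ih1

/-- A set of positions below `k + 2` either avoids `k + 1`, or consists of `k + 1` and positions
below `k`. -/
theorem rowStates_add_two (k : ℕ) :
    rowStates (k + 2) = rowStates (k + 1) ∪ (rowStates k).image (insert (k + 1)) := by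
  ext R
  rw [Finset.mem_union, Finset.mem_image, mem_rowStates, mem_rowStates]
  constructor
  · rintro ⟨h1, h2⟩
    by_cases hk : k + 1 ∈ R
    · refine Or.inr ⟨R.erase (k + 1), mem_rowStates.2 ⟨fun i hi => ?_, fun i hi j hj => ?_⟩,
        Finset.insert_erase hk⟩
      · have hi' := Finset.mem_erase.1 hi
        have := h2 i hi'.2 _ hk hi'.1
        have := Finset.mem_range.1 (h1 hi'.2)
        rw [Finset.mem_range]
        omega
      · exact h2 i (Finset.mem_of_mem_erase hi) j (Finset.mem_of_mem_erase hj)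
    · refine Or.inl ⟨fun i hi => ?_, h2⟩
      have := Finset.mem_range.1 (h1 hi)
      have : i ≠ k + 1 := fun h => hk (h ▸ hi)
      rw [Finset.mem_range]
      omega
  · rintro (⟨h1, h2⟩ | ⟨R, hR, rfl⟩)
    · exact ⟨h1.trans (Finset.range_mono (by omega)), h2⟩
    · obtain ⟨h1, h2⟩ := mem_rowStates.1 hR
      have h3 (i : ℕ) (hi : i ∈ R) : i < k := Finset.mem_range.1 (h1 hi)
      refine ⟨fun i hi => Finset.mem_range.2 ?_, fun i hi j hj hij => ?_⟩
      · rcases Finset.mem_insert.1 hi with rfl | hi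
        · omega
        · have := h3 i hi
          omega
      · rcases Finset.mem_insert.1 hi with rfl | hi <;> rcases Finset.mem_insert.1 hj with rfl | hj
        · exact absurd rfl hij
        · have := h3 j hj
          omega
        · have := h3 i hi
          omega
        · exact h2 i hi j hj hij

theorem sum_rowStates {α : Type*} [AddCommMonoid α] (k : ℕ) (φ : Finset ℕ → α) :
    ∑ R ∈ rowStates k, φ R = ((rowLists k).map fun l => φ l.toFinset).sum := by
  induction k using rowLists.induct generalizing φ with
  | case1 =>
    have : rowStates 0 = {∅} := by decide
    simp [this, rowLists]
  | case2 =>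
    have : rowStates 1 = {∅, {0}} := by decide
    simp [this, rowLists]
  | case3 k ih1 ih2 =>
    have hk {j : ℕ} (hj : j ≤ k + 1) {R : Finset ℕ} (hR : R ∈ rowStates j) :
        k + 1 ∉ R := fun h => by
      have := Finset.mem_range.1 ((mem_rowStates.1 hR).1 h)
      omega
    rw [rowStates_add_two, Finset.sum_union, Finset.sum_image, ih1, ih2, rowLists]
    · simp [Function.comp_def]
    · intro R hR R' hR' h
      rw [← Finset.erase_insert (hk (by omega) hR), ← Finset.erase_insert (hk (by omega) hR')]
      exact congrArg (Finset.erase · (k + 1)) h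
    · rw [Finset.disjoint_left]
      intro R hR h
      obtain ⟨R', -, rfl⟩ := Finset.mem_image.1 h
      exact hk le_rfl hR (Finset.mem_insert_self _ _)

/-- If no list gave `R`, summing the indicator of `{R}` in both ways would show `1 = 0`. -/
theorem exists_list_of_mem_rowStates {k : ℕ} {R : Finset ℕ} (hR : R ∈ rowStates k) :
    ∃ l ∈ rowLists k, l.toFinset = R := by
  by_contra! h
  have := sum_rowStates k fun S => if S = R then 1 else 0
  rw [Finset.sum_ite_eq_of_mem' _ _ _ hR, List.sum_eq_zero] at this
  · exact one_ne_zero this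
  · intro x hx
    obtain ⟨l, hl, rfl⟩ := List.mem_map.1 hx
    exact if_neg (h l hl)

/-- The test whether the sets given by two lists are `Compatible`. -/
def compatible (l l' : List ℕ) : Bool :=
  l.all fun i => l'.all fun j => Nat.ble (i + 2) j || Nat.ble (j + 2) i

theorem compatible_iff {l l' : List ℕ} :
    compatible l l' = true ↔ Compatible l.toFinset l'.toFinset := by
  simp [compatible, Compatible]

/-- Pairs each state `l` of a row with the list `[transfer n t m l, …, transfer n t 0 l]`. -/
def table (n t : ℕ) : ℕ → List (List ℕ × List ℕ)
  | 0 => (rowLists (n - 1)).map fun l => (l, [if l.isEmpty then 1 else 0])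
  | m + 1 => (table n t m).map fun e => (e.1, ((table n t m).map fun e' =>
      if compatible e.1 e'.1 then t ^ e'.1.length * e'.2.headD 0 else 0).sum :: e.2)

theorem table_eq (n t m : ℕ) : table n t m =
    (rowLists (n - 1)).map fun l => (l, history (fun k => transfer n t k l.toFinset) m) := by
  induction m with
  | zero => simp [table, history, transfer]
  | succ m ih =>
    have hhead (f : ℕ → ℕ) : (history f m).headD 0 = f m := by cases m <;> rfl
    rw [table, ih, List.map_map]
    refine List.map_congr_left fun l _ => ?_
    simp only [Function.comp_apply, List.map_map, history, transfer, Prod.mk.injEq, true_and,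
      List.cons.injEq, and_true]
    rw [Finset.sum_filter, sum_rowStates]
    refine congrArg List.sum (List.map_congr_left fun l' hl' => ?_)
    simp only [Function.comp_apply, compatible_iff, hhead,
      List.toFinset_card_of_nodup (rowLists_spec hl').1]

theorem map_transfer {R S : Type*} [CommSemiring R] [CommSemiring S] (φ : R →+* S) (n : ℕ) (t : R)
    (m : ℕ) (A : Finset ℕ) : φ (transfer n t m A) = transfer n (φ t) m A := by
  induction m generalizing A with
  | zero => simp only [transfer]; split_ifs <;> simp
  | succ m ih => simp [transfer, ih]

theorem NormLE.transfer (n m : ℕ) (S : Finset ℕ) :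
    NormLE (transfer n Polynomial.X m S) (transfer n 1 m S) := by
  have h := NormLE.map_natCast (SquareTiling.transfer n Polynomial.X m S)
  rw [← Polynomial.coe_evalRingHom, ← Polynomial.coe_mapRingHom, map_transfer, map_transfer] at h
  simpa using h

/-- A test of finitely many identities between integers that establishes
`genFun n 2 = p / q` for the bivariate polynomials given by `p` and `q`: with `d` the degree of `q`
in `z`, the recurrence with the coefficients `q` annihilates the first `d + 1` values of the
transfer for every state, and the coefficients of `z ^ m` in `genFun n 2 * q` and in `p` agree for
`m < d`; the latter is read off at the empty state, whose list is the history of `rowPoly n · 2`.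
These are identities between polynomials in `t`, which are tested at `t = N` only, with
the values at `t = 1` as bounds for the coefficients. -/
def certificate (n N : ℕ) (q p : List (List ℤ)) : Bool :=
  let d := q.length - 1
  let value (h : List ℕ) : ℤ := dot (q.map (intHorner (N : ℤ))) (h.map Nat.cast)
  let bound (h : List ℕ) : ℕ := dot (q.map fun c => horner 1 (c.map Int.natAbs)) h
  p.length ≤ d &&
  ((table n N d).all fun e => value e.2 = 0 && (!e.1.isEmpty || (List.range d).all fun m =>
    value (e.2.drop (d - m)) = intHorner (N : ℤ) (p.getD m []))) &&
  (table n 1 d).all fun e => bound e.2 < N && (!e.1.isEmpty || (List.range d).all fun m =>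
    bound (e.2.drop (d - m)) + horner 1 ((p.getD m []).map Int.natAbs) < N)

theorem coeff_bivariate (c : List (List ℤ)) (m : ℕ) :
    PowerSeries.coeff m (bivariate PowerSeries.X (PowerSeries.C Polynomial.X) c : ℤ[X]⟦X⟧) =
      intHorner Polynomial.X (c.getD m []) := by
  have h := coeff_horner (c.map (intHorner (Polynomial.X : ℤ[X]))) m
  simp only [List.map_map, Function.comp_def, map_intHorner] at h
  rw [bivariate, h]
  simp only [List.getD_eq_getElem?_getD, List.getElem?_map]
  cases getElem? c m <;> simp [intHorner, horner]

theorem coeff_genFun_two_mul_bivariate (n : ℕ) (c : List (List ℤ)) (m : ℕ) :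
    PowerSeries.coeff m
        (genFun n 2 * bivariate PowerSeries.X (PowerSeries.C Polynomial.X) c) =
      dot (c.map (intHorner Polynomial.X)) (history (transfer n Polynomial.X · ∅) m) := by
  rw [← coeff_mk_mul_horner, List.map_map, genFun]
  simp only [rowPoly_two_eq_transfer, bivariate, Function.comp_def, map_intHorner]

/-- If a recurrence annihilates the transfer for all states at one time, it does so at all later
times, as the transfer matrix commutes with the recurrence. -/
theorem dot_transfer_eq_zero {α : Type*} [CommRing α] (n : ℕ) (t : α) (c : List α) (d : ℕ)
    (hd : c.length ≤ d + 1)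
    (h : ∀ S ∈ rowStates (n - 1), dot c (history (transfer n t · S) d) = 0) (i : ℕ)
    {S : Finset ℕ} (hS : S ∈ rowStates (n - 1)) :
    dot c (history (transfer n t · S) (d + i)) = 0 := by
  induction i generalizing S with
  | zero => exact h S hS
  | succ i ih =>
    rw [← Nat.add_assoc, dot_history_succ _ (fun R => t ^ R.card)
      (transfer n t · S) (fun R => (transfer n t · R)) (fun m => rfl) c _ (by omega)]
    refine Finset.sum_eq_zero fun R hR => ?_
    rw [ih (Finset.mem_filter.1 hR).1, mul_zero]

theorem eval_intHorner (c : List ℤ) (x : ℤ) :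
    (intHorner Polynomial.X c : ℤ[X]).eval x = intHorner x c := by
  have := map_intHorner (Polynomial.evalRingHom x) Polynomial.X c
  simpa using this

theorem eval_dot_transfer (n : ℕ) (N : ℕ) (S : Finset ℕ) (c : List (List ℤ)) (m : ℕ) :
    (dot (c.map (intHorner Polynomial.X)) (history (transfer n Polynomial.X · S) m) : ℤ[X]).eval
        (N : ℤ) =
      dot (c.map (intHorner (N : ℤ))) ((history (transfer n N · S) m).map Nat.cast) := by
  rw [← Polynomial.coe_evalRingHom, map_dot, List.map_map, map_history, map_history]
  have h1 (m : ℕ) : ((transfer n N m S : ℕ) : ℤ) = transfer n (N : ℤ) m S := by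
    simpa using map_transfer (Nat.castRingHom ℤ) n N m S
  simp only [map_transfer, Function.comp_def, Polynomial.coe_evalRingHom, eval_intHorner,
    Polynomial.eval_X, h1]

theorem isQuotient_genFun_two {n N : ℕ} {q p : List (List ℤ)} (hq : q.head? = some [1])
    (h : certificate n N q p = true) :
    IsQuotient (genFun n 2) (bivariate PowerSeries.X (PowerSeries.C Polynomial.X) p)
      (bivariate PowerSeries.X (PowerSeries.C Polynomial.X) q) := by
  simp only [certificate, table_eq, Bool.and_eq_true, decide_eq_true_eq, List.all_eq_true,
    List.mem_map, forall_exists_index, and_imp, forall_apply_eq_imp_iff₂, Bool.or_eq_true,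
    Bool.not_eq_true', List.mem_range] at h
  obtain ⟨⟨hp, hN⟩, h1⟩ := h
  set d := q.length - 1 with hd
  have hempty : (∅ : Finset ℕ) ∈ rowStates (n - 1) := by simp [mem_rowStates]
  have hnorm (l : List ℕ) (m : ℕ) := NormLE.dot (intHorner (Polynomial.X : ℤ[X]))
    (fun c => horner 1 (c.map Int.natAbs)) NormLE.intHorner (transfer n Polynomial.X · l.toFinset)
    (transfer n 1 · l.toFinset) (fun i => NormLE.transfer n i _) q m
  constructor
  · rw [PowerSeries.isUnit_iff_constantCoeff, ← PowerSeries.coeff_zero_eq_constantCoeff_apply,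
      coeff_bivariate]
    cases q with
    | nil => simp at hq
    | cons a q =>
      obtain rfl : a = [1] := by simpa using hq
      simp [intHorner, horner]
  · ext1 m
    rw [coeff_genFun_two_mul_bivariate, coeff_bivariate]
    rcases lt_or_ge m d with hm | hm
    · have hN' := ((hN [] (nil_mem_rowLists _)).2.resolve_left (by simp)) m hm
      have h1' := ((h1 [] (nil_mem_rowLists _)).2.resolve_left (by simp)) m hm
      obtain ⟨k, hk⟩ := Nat.exists_eq_add_of_le hm.le
      rw [hk, Nat.add_sub_cancel_left, history_drop] at hN' h1'
      rw [← sub_eq_zero]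
      refine ((hnorm [] m).sub (NormLE.intHorner (p.getD m []))).eq_zero h1' ?_
      rw [Polynomial.eval_sub, sub_eq_zero, eval_intHorner]
      exact (eval_dot_transfer n N _ q m).trans hN'
    · obtain ⟨k, rfl⟩ := Nat.exists_eq_add_of_le hm
      rw [List.getD_eq_default _ _ (by omega)]
      refine dot_transfer_eq_zero n _ _ d (by rw [List.length_map]; omega) (fun S hS => ?_) k hempty
      obtain ⟨l, hl, rfl⟩ := exists_list_of_mem_rowStates hS
      refine (hnorm l d).eq_zero (h1 l hl).1 ?_
      exact (eval_dot_transfer n N _ q d).trans (hN l hl).1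

theorem map_bivariate {R S : Type*} [Ring R] [Ring S] (φ : R →+* S) (z t : R)
    (c : List (List ℤ)) : φ (bivariate z t c) = bivariate (φ z) (φ t) c := by
  induction c with
  | nil => simp [bivariate, horner]
  | cons a c ih =>
    simp only [bivariate, horner, List.map_cons, List.foldr_cons] at ih ⊢
    rw [map_add, map_mul, ih, map_intHorner]

theorem isQuotient_genFunAtOne_two {n N : ℕ} {q p : List (List ℤ)} (hq : q.head? = some [1])
    (h : certificate n N q p = true) :
    IsQuotient (genFunAtOne n 2) (bivariate PowerSeries.X 1 p) (bivariate PowerSeries.X 1 q) := by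
  obtain ⟨h1, h2⟩ := isQuotient_genFun_two hq h
  have h3 := h1.map (PowerSeries.map (Polynomial.evalRingHom (1 : ℤ)))
  have h4 := congrArg (PowerSeries.map (Polynomial.evalRingHom (1 : ℤ))) h2
  rw [map_mul, map_bivariate, map_bivariate] at h4
  rw [map_bivariate] at h3
  simp only [PowerSeries.map_X, PowerSeries.map_C, Polynomial.coe_evalRingHom, Polynomial.eval_X,
    map_one] at h3 h4
  exact ⟨h3, h4⟩

/-- A common factor may be cancelled: it is a unit because the larger denominator is one. -/
theorem IsQuotient.of_mul {R : Type*} [CommRing R] {F N D c : R⟦X⟧}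
    (h : IsQuotient F (c * N) (c * D)) : IsQuotient F N D :=
  ⟨isUnit_of_mul_isUnit_right h.1,
    (isUnit_of_mul_isUnit_left h.1).mul_left_cancel (by rw [mul_left_comm, h.2])⟩

theorem genFunAtOne_two (n : ℕ) : genFunAtOne n 2 = rowSumGenFun n 2 := by
  ext m
  have h0 (k : ℕ) (hk : n * m / 2 ^ 2 < k) : numTilings n m 2 k = 0 := by
    rw [numTilings, Finset.card_eq_zero, tilings, Finset.filter_eq_empty_iff]
    rintro ⟨A, B⟩ - ⟨-, -, h⟩
    dsimp only at h
    omega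
  rw [genFunAtOne, PowerSeries.coeff_map, genFun, PowerSeries.coeff_mk, rowSumGenFun,
    PowerSeries.coeff_mk, rowPoly, rowSum, map_sum, Nat.cast_sum]
  simp only [Polynomial.coe_evalRingHom, Polynomial.eval_monomial, one_pow, mul_one]
  symm
  refine Finset.sum_subset (Finset.range_mono ?_) fun k _ hk => ?_
  · have := Nat.div_le_self (n * m) (2 ^ 2)
    omega
  · rw [Finset.mem_range, not_lt] at hk
    rw [h0 k hk, Nat.cast_zero]

/-! ### The rectangles of widths `4` to `8` -/

/-- The coefficients of `P7`. -/
def coeffsP7 : List (List ℤ) :=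
  [[1], [0, -2], [0, 0, -5, -7], [0, 0, 0, 1, 8], [0, 0, 0, 0, 0, 3, 14],
   [0, 0, 0, 0, 0, 0, 0, -6], [0, 0, 0, 0, 0, 0, 0, 0, 0, -6]]

/-- The coefficients of `Q7`. -/
def coeffsQ7 : List (List ℤ) :=
  [[1], [-1, -2], [0, -4, -15, -11], [0, 0, -3, 4, 16], [0, 0, 0, 1, 30, 65, 42],
   [0, 0, 0, 0, 0, -5, -42, -38], [0, 0, 0, 0, 0, 0, 0, -6, -48, -62],
   [0, 0, 0, 0, 0, 0, 0, 0, 0, 18, 24], [0, 0, 0, 0, 0, 0, 0, 0, 0, 0, 0, 8, 24]]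

theorem bivariate_coeffsP7 {R : Type*} [CommRing R] (z t : R) :
    bivariate z t coeffsP7 = P7 z t := by
  simp [bivariate, intHorner, horner, coeffsP7, P7]
  ring

theorem bivariate_coeffsQ7 {R : Type*} [CommRing R] (z t : R) :
    bivariate z t coeffsQ7 = Q7 z t := by
  simp [bivariate, intHorner, horner, coeffsQ7, Q7]
  ring

/-- The coefficients of `P8`. -/
def coeffsP8 : List (List ℤ) :=
  [[1], [0, -3, -2], [0, 0, -7, -13, -2], [0, 0, 0, 5, 40, 37, 6], [0, 0, 0, 0, 2, 11, 49, 12],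
   [0, 0, 0, 0, 0, 0, -12, -104, -189, -67, -6], [0, 0, 0, 0, 0, 0, 0, 0, -4, -41, 0, 12, 2],
   [0, 0, 0, 0, 0, 0, 0, 0, 0, 0, 75, 271, 206, 43, 2],
   [0, 0, 0, 0, 0, 0, 0, 0, 0, 0, 0, 0, 1, -45, -53, -16, -1],
   [0, 0, 0, 0, 0, 0, 0, 0, 0, 0, 0, 0, 0, 0, -85, -156, -85, -10],
   [0, 0, 0, 0, 0, 0, 0, 0, 0, 0, 0, 0, 0, 0, 0, 0, 17, 39, 33, 5],
   [0, 0, 0, 0, 0, 0, 0, 0, 0, 0, 0, 0, 0, 0, 0, 0, 0, 0, 12, 28, 12],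
   [0, 0, 0, 0, 0, 0, 0, 0, 0, 0, 0, 0, 0, 0, 0, 0, 0, 0, 0, 0, -2, -8, -6]]

/-- The coefficients of `Q8`. -/
def coeffsQ8 : List (List ℤ) :=
  [[1], [-1, -3, -2], [0, -4, -20, -23, -3], [0, 0, -2, 17, 88, 60, 8],
   [0, 0, 0, 4, 68, 207, 192, 41, 2], [0, 0, 0, 0, 1, -22, -284, -720, -607, -156, -12],
   [0, 0, 0, 0, 0, 0, -13, -88, -219, -426, -105, 4, 2],
   [0, 0, 0, 0, 0, 0, 0, 0, 50, 519, 1612, 2152, 935, 154, 8],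
   [0, 0, 0, 0, 0, 0, 0, 0, 0, 0, -33, -206, -41, -202, -175, -44, -3],
   [0, 0, 0, 0, 0, 0, 0, 0, 0, 0, 0, 0, -118, -922, -2484, -1992, -592, -65, -2],
   [0, 0, 0, 0, 0, 0, 0, 0, 0, 0, 0, 0, 0, 0, 110, 268, 611, 542, 203, 27, 1],
   [0, 0, 0, 0, 0, 0, 0, 0, 0, 0, 0, 0, 0, 0, 0, 0, 7, 673, 1208, 755, 157, 10],
   [0, 0, 0, 0, 0, 0, 0, 0, 0, 0, 0, 0, 0, 0, 0, 0, 0, 0, -16, -178, -329, -273, -69, -5],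
   [0, 0, 0, 0, 0, 0, 0, 0, 0, 0, 0, 0, 0, 0, 0, 0, 0, 0, 0, 0, 2, -88, -194, -100, -12],
   [0, 0, 0, 0, 0, 0, 0, 0, 0, 0, 0, 0, 0, 0, 0, 0, 0, 0, 0, 0, 0, 0, 0, 16, 54, 44, 6]]

theorem bivariate_coeffsP8 {R : Type*} [CommRing R] (z t : R) :
    bivariate z t coeffsP8 = P8 z t := by
  simp [bivariate, intHorner, horner, coeffsP8, P8]
  ring

theorem bivariate_coeffsQ8 {R : Type*} [CommRing R] (z t : R) :
    bivariate z t coeffsQ8 = Q8 z t := by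
  simp [bivariate, intHorner, horner, coeffsQ8, Q8]
  ring

/-- In all five cases `10 ^ 24` exceeds the sums of absolute values of coefficients that occur. -/
theorem certificate_four : certificate 4 (10 ^ 24)
    [[1], [-1, -1], [0, -2, -1], [0, 0, 1, 1]]
    [[1], [0, -1]] = true := by
  decide +kernel

theorem certificate_five : certificate 5 (10 ^ 24)
    [[1], [-1, -1], [0, -3, -4], [0, 0, -1, 3], [0, 0, 0, 0, 3]]
    [[1], [0, -1], [0, 0, -1]] = true := by
  decide +kernel

theorem certificate_six : certificate 6 (10 ^ 24)
    [[1], [-1, -2], [0, -3, -8, -3], [0, 0, 0, 10, 5], [0, 0, 0, 2, 12, 11, 3],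
     [0, 0, 0, 0, 0, -9, -15, -4], [0, 0, 0, 0, 0, 0, 0, 1, -3, -1],
     [0, 0, 0, 0, 0, 0, 0, 0, 0, 3, 1]]
    [[1], [0, -2], [0, 0, -2, -2], [0, 0, 0, 2, 3], [0, 0, 0, 0, 0, 0, 1],
     [0, 0, 0, 0, 0, 0, 0, -1]] = true := by
  decide +kernel

theorem certificate_seven : certificate 7 (10 ^ 24) coeffsQ7 coeffsP7 = true := by
  decide +kernel

theorem certificate_eight : certificate 8 (10 ^ 24) coeffsQ8 coeffsP8 = true := by
  decide +kernel

end SquareTiling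

open SquareTiling in
theorem mainTheorem4 :
    (let z : ℤ[X]⟦X⟧ := PowerSeries.X
    let t : ℤ[X]⟦X⟧ := PowerSeries.C Polynomial.X
    IsQuotient (genFun 4 2)
      (1 - z * t)
      (1 - z - z * t - 2 * z ^ 2 * t - z ^ 2 * t ^ 2 + z ^ 3 * t ^ 2 + z ^ 3 * t ^ 3) ∧
    IsQuotient (genFun 5 2)
      (1 - z * t - z ^ 2 * t ^ 2)
      (1 - z - z * t - 3 * z ^ 2 * t - 4 * z ^ 2 * t ^ 2 - z ^ 3 * t ^ 2 + 3 * z ^ 3 * t ^ 3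
        + 3 * z ^ 4 * t ^ 4) ∧
    IsQuotient (genFun 6 2)
      (1 - 2 * z * t - 2 * z ^ 2 * t ^ 2 - 2 * z ^ 2 * t ^ 3 + 2 * z ^ 3 * t ^ 3
        + 3 * z ^ 3 * t ^ 4 + z ^ 4 * t ^ 6 - z ^ 5 * t ^ 7)
      (1 - z - 2 * z * t - 3 * z ^ 2 * t - 8 * z ^ 2 * t ^ 2 - 3 * z ^ 2 * t ^ 3
        + 10 * z ^ 3 * t ^ 3 + 5 * z ^ 3 * t ^ 4 + 2 * z ^ 4 * t ^ 3 + 12 * z ^ 4 * t ^ 4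
        + 11 * z ^ 4 * t ^ 5 + 3 * z ^ 4 * t ^ 6 - 9 * z ^ 5 * t ^ 5 - 15 * z ^ 5 * t ^ 6
        - 4 * z ^ 5 * t ^ 7 + z ^ 6 * t ^ 7 - 3 * z ^ 6 * t ^ 8 - z ^ 6 * t ^ 9
        + 3 * z ^ 7 * t ^ 9 + z ^ 7 * t ^ 10) ∧
    IsQuotient (genFun 7 2) (P7 z t) (Q7 z t) ∧
    IsQuotient (genFun 8 2) (P8 z t) (Q8 z t)) ∧
    (∀ n : ℕ, genFunAtOne n 2 = rowSumGenFun n 2) ∧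
    (let z : ℤ⟦X⟧ := PowerSeries.X
    IsQuotient (genFunAtOne 4 2)
      (1 - z)
      (1 - 2 * z - 3 * z ^ 2 + 2 * z ^ 3) ∧
    IsQuotient (genFunAtOne 5 2)
      (1 - z - z ^ 2)
      (1 - 2 * z - 7 * z ^ 2 + 2 * z ^ 3 + 3 * z ^ 4) ∧
    IsQuotient (genFunAtOne 6 2)
      (1 - z - 5 * z ^ 2 + z ^ 4)
      (1 - 2 * z - 16 * z ^ 2 - z ^ 3 + 27 * z ^ 4 - z ^ 5 - 4 * z ^ 6) ∧
    IsQuotient (genFunAtOne 7 2)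
      (1 - 2 * z - 12 * z ^ 2 + 9 * z ^ 3 + 17 * z ^ 4 - 6 * z ^ 5 - 6 * z ^ 6)
      (1 - 3 * z - 30 * z ^ 2 + 17 * z ^ 3 + 138 * z ^ 4 - 85 * z ^ 5 - 116 * z ^ 6 + 42 * z ^ 7
        + 32 * z ^ 8) ∧
    IsQuotient (genFunAtOne 8 2)
      (1 - 5 * z - 22 * z ^ 2 + 88 * z ^ 3 + 74 * z ^ 4 - 378 * z ^ 5 - 31 * z ^ 6 + 597 * z ^ 7
        - 114 * z ^ 8 - 336 * z ^ 9 + 94 * z ^ 10 + 52 * z ^ 11 - 16 * z ^ 12)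
      (1 - 6 * z - 50 * z ^ 2 + 171 * z ^ 3 + 514 * z ^ 4 - 1800 * z ^ 5 - 845 * z ^ 6
        + 5430 * z ^ 7 - 704 * z ^ 8 - 6175 * z ^ 9 + 1762 * z ^ 10 + 2810 * z ^ 11 - 870 * z ^ 12
        - 392 * z ^ 13 + 120 * z ^ 14)) := by
  refine ⟨⟨?_, ?_, ?_, ?_, ?_⟩, genFunAtOne_two, ?_, ?_, ?_, ?_, ?_⟩
  · convert isQuotient_genFun_two rfl certificate_four using 1 <;>
      simp [bivariate, intHorner, horner] <;> ring
  · convert isQuotient_genFun_two rfl certificate_five using 1 <;>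
      simp [bivariate, intHorner, horner] <;> ring
  · convert isQuotient_genFun_two rfl certificate_six using 1 <;>
      simp [bivariate, intHorner, horner] <;> ring
  · simpa only [bivariate_coeffsP7, bivariate_coeffsQ7] using
      isQuotient_genFun_two rfl certificate_seven
  · simpa only [bivariate_coeffsP8, bivariate_coeffsQ8] using
      isQuotient_genFun_two rfl certificate_eight
  · convert isQuotient_genFunAtOne_two rfl certificate_four using 1 <;>
      simp [bivariate, intHorner, horner] <;> ring
  · convert isQuotient_genFunAtOne_two rfl certificate_five using 1 <;>
      simp [bivariate, intHorner, horner] <;> ring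
  -- At `t = 1` the numerator and the denominator for `n = 6` have the common factor `1 - z`.
  · apply IsQuotient.of_mul (c := 1 - PowerSeries.X)
    convert isQuotient_genFunAtOne_two rfl certificate_six using 1 <;>
      simp [bivariate, intHorner, horner] <;> ring
  · convert isQuotient_genFunAtOne_two rfl certificate_seven using 1
    · rw [bivariate_coeffsP7, P7]
      ring
    · rw [bivariate_coeffsQ7, Q7]
      ring
  · convert isQuotient_genFunAtOne_two rfl certificate_eight using 1
    · rw [bivariate_coeffsP8, P8]
      ring
    · rw [bivariate_coeffsQ8, Q8]
      ring
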